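/- Let $k$ be a field of characteristic zero and let $M=(m_{ij})$ be a $d\times m$ matrix over $k$ of rank $d$ with no zero columns. Let $B=k[x_1,\dots,x_m]/(x_1^2,\dots,x_m^2)$ with its standard grading $B=\bigoplus_{j=0}^m B_j$, and let $A(M)\subseteq B$ be the $k$-subalgebra generated by the $d$ linear forms $\sum_{j=1}^m m_{ij}x_j$ ($1\le i\le d$) given by the rows of $M$, graded by $A(M)_j=A(M)\cap B_j$. Its Poincaré polynomial is $P(A(M);t)=\sum_{j=0}^m \dim_k(A(M)_j)\,t^j$. Suppose that $M$ represents the matroid $\mathcal M$, that is, the columns of $M$ can be labelled bijectively by the elements of the ground set $E$ of $\mathcal M$ so that the linearly independent sets of columns are exactly the independent sets of $\mathcal M$. Then $P(A(M);t)$ depends only on $\mathcal M$: if $N$ is another matrix of full row rank with no zero columns, over any field of characteristic zero, and $N$ also represents $\mathcal M$, then $P(A(N);t)=P(A(M);t)$. Moreover, as Laurent polynomials in $t$, $$P(A(M);t)=t^{m-d}\,T_{\mathcal M}(1+t,\,t^{-1}),$$ where $T_{\mathcal M}(x,y)=\sum_{S\subseteq E}(x-1)^{r(E)-r(S)}(y-1)^{\#S-r(S)}$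 is the Tutte polynomial of $\mathcal M$ and $r$ is its rank function. -/

import Mathlib

/-- The ideal `(x₁², …, xₘ²)` of `k[x₁, …, xₘ]`. -/
noncomputable def squareIdeal (k : Type*) [Field k] (m : ℕ) : Ideal (MvPolynomial (Fin m) k) :=
  Ideal.span (Set.range fun j : Fin m => (MvPolynomial.X j : MvPolynomial (Fin m) k) ^ 2)

/-- The algebra `B = k[x₁, …, xₘ] / (x₁², …, xₘ²)`. -/
abbrev SquareZeroAlgebra (k : Type*) [Field k] (m : ℕ) : Type _ :=
  MvPolynomial (Fin m) k ⧸ squareIdeal k m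

/-- The homogeneous component `B_j` of `B`: the classes of the homogeneous polynomials of
degree `j`. -/
noncomputable def squareZeroComponent (k : Type*) [Field k] (m j : ℕ) :
    Submodule k (SquareZeroAlgebra k m) :=
  (MvPolynomial.homogeneousSubmodule (Fin m) k j).map
    (Ideal.Quotient.mkₐ k (squareIdeal k m)).toLinearMap

/-- The linear form `∑ⱼ M i j • xⱼ` of `B` given by row `i` of `M`. -/
noncomputable def rowForm {k : Type*} [Field k] {d m : ℕ} (M : Matrix (Fin d) (Fin m) k)
    (i : Fin d) : SquareZeroAlgebra k m :=
  ∑ j : Fin m, M i j • Ideal.Quotient.mkₐ k (squareIdeal k m) (MvPolynomial.X j)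

/-- The algebra `A(M)`: the subalgebra of `B` generated by the rows of `M`. -/
noncomputable def rowAlgebra {k : Type*} [Field k] {d m : ℕ} (M : Matrix (Fin d) (Fin m) k) :
    Subalgebra k (SquareZeroAlgebra k m) :=
  Algebra.adjoin k (Set.range (rowForm M))

/-- The homogeneous component `A(M)_j = A(M) ∩ B_j`. -/
noncomputable def rowAlgebraComponent {k : Type*} [Field k] {d m : ℕ}
    (M : Matrix (Fin d) (Fin m) k) (j : ℕ) : Submodule k (SquareZeroAlgebra k m) :=
  Subalgebra.toSubmodule (rowAlgebra M) ⊓ squareZeroComponent k m j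

/-- The Poincaré polynomial `∑_{j = 0}^m dim_k A(M)_j t^j` of `A(M)`. -/
noncomputable def poincarePolynomial {k : Type*} [Field k] {d m : ℕ}
    (M : Matrix (Fin d) (Fin m) k) : Polynomial ℤ :=
  ∑ j ∈ Finset.range (m + 1),
    Polynomial.monomial j (Module.finrank k (rowAlgebraComponent M j) : ℤ)

/-- `M` represents the matroid `𝓜`: the columns of `M` can be labelled bijectively by the elements
of the ground set of `𝓜` in such a way that the linearly independent sets of columns are exactly
the independent sets of `𝓜`. (A set of columns is a set of column indices, so that two equal
columns at different positions are dependent.) -/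
def Represents {k : Type*} [Field k] {d m : ℕ} {α : Type*} (M : Matrix (Fin d) (Fin m) k)
    (𝓜 : Matroid α) : Prop :=
  ∃ e : Fin m → α, Set.BijOn e Set.univ 𝓜.E ∧
    ∀ I : Set (Fin m), 𝓜.Indep (e '' I) ↔ LinearIndepOn k M.col I

/-- The rank `r(S)` in a matroid, as a natural number (used for finite matroids only). -/
noncomputable def matroidRank {α : Type*} (𝓜 : Matroid α) (S : Set α) : ℕ :=
  (𝓜.eRk S).toNat

/-- The Tutte polynomial
`T(x, y) = ∑_{S ⊆ E} (x - 1) ^ (r(E) - r(S)) (y - 1) ^ (#S - r(S))` of a finite matroid;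
`X 0` is `x` and `X 1` is `y`. The exponents are differences of natural numbers that are
never negative. -/
noncomputable def tuttePolynomial {α : Type*} (𝓜 : Matroid α) [𝓜.Finite] :
    MvPolynomial (Fin 2) ℤ :=
  ∑ S ∈ 𝓜.ground_finite.toFinset.powerset,
    (MvPolynomial.X 0 - 1) ^ (matroidRank 𝓜 𝓜.E - matroidRank 𝓜 (S : Set α)) *
      (MvPolynomial.X 1 - 1) ^ (S.card - matroidRank 𝓜 (S : Set α))

/-!
# The Poincaré polynomial of the algebra generated by the rows of a matrix

Both sides of the identity satisfy the same deletion-contraction recursion. For a space `V` of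
coefficient vectors and a set `E` of columns, let `A(V, E)` be the algebra generated by the linear
forms of `V` in the variables `xⱼ`, `j ∈ E`. If a functional `coord M e`, `e ∉ E`, is not zero on
`V`, with kernel `V₀` in `V`, then differentiation with respect to `xₑ` gives exact sequences
`0 → A(V₀, E)_j → A(V, E ∪ {e})_j → A(V, E)_{j - 1} → 0`
(`RowAlgebra.map_deriv_forms_pow` and `RowAlgebra.forms_pow_inf_ker_deriv`); if it vanishes on `V`,
then `A(V, E ∪ {e}) = A(V, E)`. Surjectivity is integration of polynomials, which needs
characteristic zero.

Exactness in the middle is the substantial point. It rests on the presentation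
`RowAlgebra.mem_powerIdeal_of_phi_eq_zero`: `A(V, E)` is the polynomial algebra on `V` modulo the
powers `v ^ (ρ(v) + 1)`, where `ρ(v)` is the number of variables in the linear form of `v`. This is
proved by the same induction: the `e`-derivatives of the relations of `A(V, E ∪ {e})` include all
relations of `A(V, E)`, since `ρ(v)` drops by one on deleting `e` exactly when `v` has a nonzero
derivative. So a polynomial in `V` that vanishes in `A(V, E ∪ {e})` agrees, modulo these powers,
with a polynomial in `V` of derivative zero, that is, with a polynomial in `V₀`.

On the other side, `t ^ (m - d) T(1 + t, t⁻¹) = ∑_S t ^ (m - |S|) (1 - t) ^ (|S| - r(S))`, and this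
sum is split according to whether `e ∈ S` (`RowAlgebra.tutteSum_insert_of_ne_zero`). The recursion
ends at `E = ∅`, where the algebra is `k` and the sum is `1`. Deleting a variable amounts to
restricting the sum that defines a linear form, so all algebras stay inside the same `B`.

The independence of the representation follows, because `m` and `d` are the size and the rank of
the matroid.
-/

/-! ### Powers of a subspace -/

namespace Submodule

variable {k A : Type*} [Field k] [CommRing A] [Algebra k A]

lemma mul_mem_pow_add {L : Submodule k A} {i j : ℕ}
    {a b : A} (ha : a ∈ L ^ i) (hb : b ∈ L ^ j) : a * b ∈ L ^ (i + j) := by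
  rw [pow_add]
  exact Submodule.mul_mem_mul ha hb

lemma pow_le_adjoin (L : Submodule k A) (j : ℕ) :
    L ^ j ≤ Subalgebra.toSubmodule (Algebra.adjoin k (L : Set A)) := by
  induction j with
  | zero =>
    rw [Submodule.pow_zero, Submodule.one_le]
    exact one_mem (Algebra.adjoin k (L : Set A))
  | succ j ih =>
    rw [Submodule.pow_succ, Submodule.mul_le]
    exact fun a ha b hb =>
      (Algebra.adjoin k (L : Set A)).mul_mem (ih ha) (Algebra.subset_adjoin hb)

end Submodule

/-! ### The square-zero algebra -/

namespace SquareZeroAlgebra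

section

variable (k : Type*) [Field k] (m : ℕ)

/-- The class `xⱼ` of the variable `X j`. -/
noncomputable def x (j : Fin m) : SquareZeroAlgebra k m :=
  Ideal.Quotient.mkₐ k (squareIdeal k m) (MvPolynomial.X j)

variable {k m}

lemma x_sq (j : Fin m) : x k m j ^ 2 = 0 := by
  rw [x, ← map_pow]
  exact Ideal.Quotient.eq_zero_iff_mem.mpr (Ideal.subset_span ⟨j, rfl⟩)

lemma mk_eq_aeval (f : MvPolynomial (Fin m) k) :
    Ideal.Quotient.mkₐ k (squareIdeal k m) f = MvPolynomial.aeval (x k m) f := by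
  have : Ideal.Quotient.mkₐ k (squareIdeal k m) = MvPolynomial.aeval (x k m) :=
    MvPolynomial.algHom_ext fun j => by rw [MvPolynomial.aeval_X]; rfl
  rw [this]

/-- The universal property of `B`: elements of square zero determine an algebra map from `B`. -/
noncomputable def lift {A : Type*} [CommRing A] [Algebra k A] (a : Fin m → A)
    (ha : ∀ j, a j ^ 2 = 0) : SquareZeroAlgebra k m →ₐ[k] A :=
  Ideal.Quotient.liftₐ (squareIdeal k m) (MvPolynomial.aeval a) fun f hf => by
    have h : squareIdeal k m ≤ RingHom.ker (MvPolynomial.aeval (R := k) a) := by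
      rw [squareIdeal, Ideal.span_le]
      rintro _ ⟨j, rfl⟩
      simp [RingHom.mem_ker, ha]
    exact h hf

@[simp] lemma lift_x {A : Type*} [CommRing A] [Algebra k A] (a : Fin m → A)
    (ha : ∀ j, a j ^ 2 = 0) (j : Fin m) : lift (k := k) a ha (x k m j) = a j := by
  have : lift (k := k) a ha (x k m j) = MvPolynomial.aeval a (MvPolynomial.X j) := rfl
  rw [this, MvPolynomial.aeval_X]

instance : Nontrivial (SquareZeroAlgebra k m) :=
  (lift (k := k) (m := m) (A := k) (fun _ => 0) (by simp)).toRingHom.domain_nontrivial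

/-- The algebra map `b ↦ b₀ + b₁ ε`, where `b = b₀ + xₑ b₁` with `b₀` and `b₁` free of `xₑ`.
Its `ε`-component is the derivative with respect to `xₑ`, which does not exist as a derivation
of `B` itself. -/
noncomputable def toDual (e : Fin m) :
    SquareZeroAlgebra k m →ₐ[k] DualNumber (SquareZeroAlgebra k m) :=
  lift (fun j => if j = e then DualNumber.eps else TrivSqZeroExt.inl (x k m j)) fun j => by
    split_ifs
    · exact DualNumber.eps_pow_two
    · rw [sq, ← TrivSqZeroExt.inl_mul, ← sq, x_sq, TrivSqZeroExt.inl_zero]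

/-- The derivative with respect to `xₑ`: it sends `b₀ + xₑ b₁`, where `b₀` and `b₁` are free of
`xₑ`, to `b₁`. -/
noncomputable def deriv (e : Fin m) : SquareZeroAlgebra k m →ₗ[k] SquareZeroAlgebra k m where
  toFun b := TrivSqZeroExt.snd (toDual e b)
  map_add' a b := by simp
  map_smul' c b := by simp

lemma deriv_apply (e : Fin m) (b : SquareZeroAlgebra k m) :
    deriv e b = TrivSqZeroExt.snd (toDual e b) := rfl

/-- The algebra map `xⱼ ↦ t xⱼ`, which multiplies elements of degree `i` by `t ^ i`. -/
noncomputable def grade : SquareZeroAlgebra k m →ₐ[k] Polynomial (SquareZeroAlgebra k m) :=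
  lift (fun j => Polynomial.monomial 1 (x k m j)) fun j => by
    rw [Polynomial.monomial_pow, x_sq, map_zero]

/-- Elements of `B_j` are eigenvectors of `grade`. This is all that is used of the directness of
the grading of `B`: comparing coefficients of `t` separates the homogeneous components. -/
lemma grade_of_mem_component {j : ℕ} {b : SquareZeroAlgebra k m}
    (hb : b ∈ squareZeroComponent k m j) : grade b = Polynomial.monomial j b := by
  obtain ⟨f, hf, rfl⟩ := hb
  rw [SetLike.mem_coe, MvPolynomial.mem_homogeneousSubmodule] at hf
  have hsum : f = ∑ s ∈ f.support, MvPolynomial.monomial s (f.coeff s) := f.as_sum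
  rw [hsum]
  simp only [map_sum]
  refine Finset.sum_congr rfl fun s hs => ?_
  have hdeg : s.degree = j := by
    have := hf (MvPolynomial.mem_support_iff.mp hs)
    rw [Finsupp.degree_eq_weight_one]; exact this
  rw [AlgHom.toLinearMap_apply, mk_eq_aeval, MvPolynomial.aeval_monomial, map_mul, AlgHom.commutes,
    Finsupp.prod, map_prod]
  simp only [map_pow, grade, lift_x, Polynomial.monomial_pow, one_mul]
  rw [Polynomial.algebraMap_apply, ← Polynomial.monomial_zero_left, ← hdeg]
  have hprod : ∀ (u : Finset (Fin m)), ∏ i ∈ u, Polynomial.monomial (s i) (x k m i ^ s i) =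
      Polynomial.monomial (∑ i ∈ u, s i) (∏ i ∈ u, x k m i ^ s i) := by
    intro u
    induction u using Finset.induction_on with
    | empty => simp
    | insert a u ha ih =>
      rw [Finset.prod_insert ha, ih, Polynomial.monomial_mul_monomial, Finset.sum_insert ha,
        Finset.prod_insert ha]
  rw [hprod, Polynomial.monomial_mul_monomial, zero_add]
  rfl

lemma component_mul_le (i j : ℕ) :
    squareZeroComponent k m i * squareZeroComponent k m j ≤ squareZeroComponent k m (i + j) := by
  rw [squareZeroComponent, squareZeroComponent, ← Submodule.map_mul]
  exact Submodule.map_mono (MvPolynomial.homogeneousSubmodule_mul i j)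

lemma pow_le_component {L : Submodule k (SquareZeroAlgebra k m)}
    (hL : L ≤ squareZeroComponent k m 1) (j : ℕ) : L ^ j ≤ squareZeroComponent k m j := by
  induction j with
  | zero =>
    rw [Submodule.pow_zero, Submodule.one_le]
    exact ⟨1, MvPolynomial.isHomogeneous_one _ _, map_one (Ideal.Quotient.mkₐ k (squareIdeal k m))⟩
  | succ j ih =>
    rw [Submodule.pow_succ]
    exact Submodule.mul_le.mpr fun a ha b hb =>
      component_mul_le j 1 (Submodule.mul_mem_mul (ih ha) (hL hb))

lemma coeff_grade_mem_pow {L : Submodule k (SquareZeroAlgebra k m)}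
    (hL : L ≤ squareZeroComponent k m 1) {a : SquareZeroAlgebra k m}
    (ha : a ∈ Algebra.adjoin k (L : Set (SquareZeroAlgebra k m))) (j : ℕ) :
    (grade a).coeff j ∈ L ^ j := by
  induction ha using Algebra.adjoin_induction generalizing j with
  | mem b hb =>
    rw [grade_of_mem_component (hL hb), Polynomial.coeff_monomial]
    split_ifs with h
    · rw [← h, Submodule.pow_one]; exact hb
    · exact zero_mem _
  | algebraMap r =>
    rw [AlgHom.commutes, Polynomial.algebraMap_apply, Polynomial.coeff_C]
    split_ifs with h
    · rw [h, Submodule.pow_zero]; exact Submodule.algebraMap_mem r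
    · exact zero_mem _
  | add a b _ _ iha ihb =>
    rw [map_add, Polynomial.coeff_add]
    exact add_mem (iha j) (ihb j)
  | mul a b _ _ iha ihb =>
    rw [map_mul, Polynomial.coeff_mul]
    refine sum_mem fun p hp => ?_
    rw [← Finset.HasAntidiagonal.mem_antidiagonal.mp hp]
    exact Submodule.mul_mem_pow_add (iha _) (ihb _)

/-- The degree `j` part of the algebra generated by a space `L` of linear forms is `L ^ j`. -/
lemma adjoin_inf_component {L : Submodule k (SquareZeroAlgebra k m)}
    (hL : L ≤ squareZeroComponent k m 1) (j : ℕ) :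
    Subalgebra.toSubmodule (Algebra.adjoin k (L : Set (SquareZeroAlgebra k m))) ⊓
      squareZeroComponent k m j = L ^ j := by
  refine le_antisymm ?_ (le_inf (Submodule.pow_le_adjoin L j) (pow_le_component hL j))
  rintro a ⟨ha, haj⟩
  have := coeff_grade_mem_pow hL ha j
  rwa [grade_of_mem_component haj, Polynomial.coeff_monomial, if_pos rfl] at this

lemma sum_smul_x_pow (c : Fin m → k) (s : Finset (Fin m)) :
    (∑ j ∈ s, c j • x k m j) ^ (s.card + 1) = 0 := by
  induction s using Finset.induction_on with
  | empty => simp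
  | insert a s ha ih =>
    rw [Finset.sum_insert ha, Finset.card_insert_of_notMem ha]
    refine (Commute.all _ _).add_pow_eq_zero_of_add_le_succ_of_pow_eq_zero (m := 2) ?_ ih (by omega)
    rw [smul_pow, x_sq, smul_zero]

lemma x_mem_component (j : Fin m) : x k m j ∈ squareZeroComponent k m 1 :=
  ⟨MvPolynomial.X j, MvPolynomial.isHomogeneous_X _ _, rfl⟩

end

end SquareZeroAlgebra

/-! ### Derivations that are constant on a space of generators -/

namespace Derivation

variable {k S : Type*} [Field k] [CommRing S] [Algebra k S] {δ : Derivation k S S}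
  {W : Submodule k S}

lemma iterate_mul_eq_zero (n : ℕ) : ∀ (i j : ℕ) (f g : S), i + j = n → δ^[i] f = 0 →
    δ^[j] g = 0 → δ^[n] (f * g) = 0 := by
  induction n with
  | zero =>
    intro i j f g hij hf hg
    obtain rfl : i = 0 := by omega
    simp_all
  | succ n ih =>
    intro i j f g hij hf hg
    have hzero : δ^[n + 1] 0 = 0 := iterate_map_zero δ (n + 1)
    rcases i with _ | i
    · rw [Function.iterate_zero, id] at hf
      rw [hf, zero_mul, hzero]
    rcases j with _ | j
    · rw [Function.iterate_zero, id] at hg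
      rw [hg, mul_zero, hzero]
    rw [Function.iterate_succ_apply, leibniz, smul_eq_mul, smul_eq_mul, iterate_map_add,
      ih (i + 1) j f (δ g) (by omega) hf hg, mul_comm g,
      ih i (j + 1) (δ f) g (by omega) hf hg, add_zero]

lemma exists_iterate_eq_zero (hW : ∀ w ∈ W, ∃ c : k, δ w = algebraMap k S c) {f : S}
    (hf : f ∈ Algebra.adjoin k (W : Set S)) : ∃ n, δ^[n] f = 0 := by
  induction hf using Algebra.adjoin_induction with
  | mem w hw =>
    obtain ⟨c, hc⟩ := hW w hw
    exact ⟨2, by simp [hc]⟩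
  | algebraMap r => exact ⟨1, by simp⟩
  | add f g _ _ hf hg =>
    obtain ⟨i, hi⟩ := hf
    obtain ⟨j, hj⟩ := hg
    refine ⟨i + j, ?_⟩
    rw [iterate_map_add, add_comm i j, Function.iterate_add_apply, hi, iterate_map_zero,
      add_comm j i, Function.iterate_add_apply, hj, iterate_map_zero, add_zero]
  | mul f g _ _ hf hg =>
    obtain ⟨i, hi⟩ := hf
    obtain ⟨j, hj⟩ := hg
    exact ⟨i + j, iterate_mul_eq_zero _ i j f g rfl hi hj⟩

lemma apply_mem_adjoin (hW : ∀ w ∈ W, ∃ c : k, δ w = algebraMap k S c) {f : S}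
    (hf : f ∈ Algebra.adjoin k (W : Set S)) : δ f ∈ Algebra.adjoin k (W : Set S) := by
  induction hf using Algebra.adjoin_induction with
  | mem w hw =>
    obtain ⟨c, hc⟩ := hW w hw
    rw [hc]
    exact Subalgebra.algebraMap_mem _ c
  | algebraMap r => rw [map_algebraMap]; exact zero_mem _
  | add f g _ _ hf hg => rw [map_add]; exact add_mem hf hg
  | mul f g hf' hg' hf hg =>
    rw [leibniz, smul_eq_mul, smul_eq_mul]
    exact add_mem (mul_mem hf' hg) (mul_mem hg' hf)

lemma apply_mem_pow (hW : ∀ w ∈ W, ∃ c : k, δ w = algebraMap k S c) (j : ℕ) :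
    ∀ f ∈ W ^ (j + 1), δ f ∈ W ^ j := by
  induction j with
  | zero =>
    intro f hf
    rw [zero_add, Submodule.pow_one] at hf
    obtain ⟨c, hc⟩ := hW f hf
    rw [hc, Submodule.pow_zero]
    exact Submodule.algebraMap_mem c
  | succ j ih =>
    intro f hf
    rw [Submodule.pow_succ] at hf
    refine Submodule.mul_induction_on hf (fun a ha w hw => ?_) fun a b ha hb => ?_
    · obtain ⟨c, hc⟩ := hW w hw
      rw [leibniz, smul_eq_mul, smul_eq_mul, hc, mul_comm a, ← Algebra.smul_def, mul_comm w,
        Submodule.pow_succ]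
      exact add_mem (Submodule.smul_mem _ c ha) (Submodule.mul_mem_mul (ih a ha) hw)
    · rw [map_add]; exact add_mem ha hb

lemma apply_pow_succ_mul {y : S} {c : k} (hy : δ y = algebraMap k S c) (n : ℕ) (a : S) :
    δ (y ^ (n + 1) * a) = ((n + 1 : k) * c) • (y ^ n * a) + y ^ (n + 1) * δ a := by
  rw [leibniz, leibniz_pow, hy, Algebra.smul_def ((n + 1 : k) * c)]
  simp only [smul_eq_mul, nsmul_eq_mul, Nat.add_sub_cancel, map_mul, map_add, map_one]
  push_cast
  ring

lemma apply_eq_zero_of_mem_adjoin (hW : ∀ w ∈ W, δ w = 0) {f : S}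
    (hf : f ∈ Algebra.adjoin k (W : Set S)) : δ f = 0 := by
  induction hf using Algebra.adjoin_induction with
  | mem w hw => exact hW w hw
  | algebraMap r => exact map_algebraMap δ r
  | add f g _ _ hf hg => rw [map_add, hf, hg, add_zero]
  | mul f g _ _ hf hg => rw [leibniz, hf, hg, smul_zero, smul_zero, add_zero]

variable [CharZero k]

/-- If `δ y` is a nonzero constant, then `yⁿ a` has an antiderivative divisible by `yⁿ⁺¹`. -/
lemma exists_apply_pow_succ_mul (hW : ∀ w ∈ W, ∃ c : k, δ w = algebraMap k S c) {y : S}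
    (hyW : y ∈ W) {c : k} (hc : c ≠ 0) (hy : δ y = algebraMap k S c) {a : S}
    (ha : a ∈ Algebra.adjoin k (W : Set S)) (n : ℕ) :
    ∃ b ∈ Algebra.adjoin k (W : Set S), δ (y ^ (n + 1) * b) = y ^ n * a := by
  obtain ⟨N, hN⟩ := exists_iterate_eq_zero hW ha
  induction N generalizing a n with
  | zero =>
    rw [Function.iterate_zero, id] at hN
    exact ⟨0, zero_mem _, by simp [hN]⟩
  | succ N ih =>
    -- Integration by parts: `δ (yⁿ⁺¹ a) = (n + 1) c yⁿ a + yⁿ⁺¹ δ a`, and `δ a` dies earlier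
    -- than `a` under iteration of `δ`.
    obtain ⟨b, hb, hδ⟩ := ih (apply_mem_adjoin hW ha) (n + 1) hN
    have hn : ((n + 1 : k) * c) ≠ 0 := mul_ne_zero (by exact_mod_cast n.succ_ne_zero) hc
    refine ⟨((n + 1 : k) * c)⁻¹ • (a - y * b), Subalgebra.smul_mem _
      (sub_mem ha (mul_mem (Algebra.subset_adjoin hyW) hb)) _, ?_⟩
    have : y ^ (n + 1) * (a - y * b) = y ^ (n + 1) * a - y ^ (n + 1 + 1) * b := by ring
    rw [mul_smul_comm, map_smul, this, map_sub, apply_pow_succ_mul hy, hδ, add_sub_cancel_right,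
      inv_smul_smul₀ hn]

/-- The graded form of `Derivation.exists_apply_pow_succ_mul`. -/
lemma exists_mem_pow_apply_eq (hW : ∀ w ∈ W, ∃ c : k, δ w = algebraMap k S c) {y : S}
    (hyW : y ∈ W) {c : k} (hc : c ≠ 0) (hy : δ y = algebraMap k S c) (j : ℕ) :
    ∀ (n : ℕ), ∀ a ∈ W ^ j, ∃ b ∈ W ^ (n + 1 + j), δ b = y ^ n * a := by
  induction j with
  | zero =>
    intro n a ha
    have hn : ((n + 1 : k) * c) ≠ 0 := mul_ne_zero (by exact_mod_cast n.succ_ne_zero) hc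
    refine ⟨((n + 1 : k) * c)⁻¹ • (y ^ (n + 1) * a), Submodule.smul_mem _ _
      (Submodule.mul_mem_pow_add (Submodule.pow_mem_pow W hyW _) ha), ?_⟩
    rw [Submodule.pow_zero] at ha
    obtain ⟨r, rfl⟩ := Submodule.mem_one.mp ha
    rw [map_smul, apply_pow_succ_mul hy, map_algebraMap, mul_zero, add_zero, inv_smul_smul₀ hn]
  | succ j ih =>
    intro n a ha
    have hn : ((n + 1 : k) * c) ≠ 0 := mul_ne_zero (by exact_mod_cast n.succ_ne_zero) hc
    obtain ⟨b, hb, hδ⟩ := ih (n + 1) (δ a) (apply_mem_pow hW j a ha)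
    refine ⟨((n + 1 : k) * c)⁻¹ • (y ^ (n + 1) * a - b), Submodule.smul_mem _ _ (sub_mem
      (Submodule.mul_mem_pow_add (Submodule.pow_mem_pow W hyW _) ha) ?_), ?_⟩
    · rwa [show n + 1 + (j + 1) = n + 1 + 1 + j by omega]
    · rw [map_smul, map_sub, apply_pow_succ_mul hy, hδ, add_sub_cancel_right, inv_smul_smul₀ hn]

/-- A nonzero `h` cannot satisfy `(n + 1) h = -y δ h`: applying `δ` gives the same equation with
`δ h` and `n + 2` in place of `h` and `n + 1`, and iterates of `δ` kill `h`. -/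
lemma eq_zero_of_smul_eq_neg_mul {y : S} (hy : δ y = 1) {N : ℕ} : ∀ (n : ℕ) (h : S),
    δ^[N] h = 0 → ((n + 1 : ℕ) : k) • h = -(y * δ h) → h = 0 := by
  induction N with
  | zero => intro n h hN _; simpa using hN
  | succ N ih =>
    intro n h hN hh
    have hδ : δ h = 0 := by
      refine ih (n + 1) (δ h) hN ?_
      have := congrArg δ hh
      rw [map_smul, map_neg, leibniz, hy, smul_eq_mul, smul_eq_mul, mul_one] at this
      rw [Nat.cast_succ, add_smul, one_smul, this]
      ring
    rw [hδ, mul_zero, neg_zero] at hh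
    exact (smul_eq_zero.mp hh).resolve_left (by exact_mod_cast n.succ_ne_zero)

/-- If `W` is spanned by `y` and a subspace `W₀` of the kernel of `δ`, where `δ y = 1`, then the
kernel of `δ` on the algebra generated by `W` is the algebra generated by `W₀`. -/
lemma mem_adjoin_of_apply_eq_zero {W₀ : Submodule k S}
    (hW : ∀ w ∈ W, ∃ c : k, δ w = algebraMap k S c)
    {y : S} (hyW : y ∈ W) (hy : δ y = 1) (hW₀W : W₀ ≤ W) (hW₀ : ∀ w ∈ W₀, δ w = 0)
    (hdec : ∀ w ∈ W, ∃ w₀ ∈ W₀, ∃ c : k, w = w₀ + c • y) {f : S}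
    (hf : f ∈ Algebra.adjoin k (W : Set S)) (hδf : δ f = 0) :
    f ∈ Algebra.adjoin k (W₀ : Set S) := by
  have hle : Algebra.adjoin k (W₀ : Set S) ≤ Algebra.adjoin k (W : Set S) :=
    Algebra.adjoin_mono hW₀W
  -- Division by `y` with remainder in the algebra generated by `W₀`.
  have hrem : ∃ u ∈ Algebra.adjoin k (W₀ : Set S), ∃ h ∈ Algebra.adjoin k (W : Set S),
      f = u + y * h := by
    clear hδf
    induction hf using Algebra.adjoin_induction with
    | mem w hw =>
      obtain ⟨w₀, hw₀, c, rfl⟩ := hdec w hw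
      exact ⟨w₀, Algebra.subset_adjoin hw₀, algebraMap k S c, Subalgebra.algebraMap_mem _ c, by
        rw [Algebra.smul_def, mul_comm y]⟩
    | algebraMap r => exact ⟨_, Subalgebra.algebraMap_mem _ r, 0, zero_mem _, by simp⟩
    | add f g _ _ hf hg =>
      obtain ⟨u, hu, h, hh, rfl⟩ := hf
      obtain ⟨u', hu', h', hh', rfl⟩ := hg
      exact ⟨u + u', add_mem hu hu', h + h', add_mem hh hh', by ring⟩
    | mul f g _ _ hf hg =>
      obtain ⟨u, hu, h, hh, rfl⟩ := hf
      obtain ⟨u', hu', h', hh', rfl⟩ := hg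
      exact ⟨u * u', mul_mem hu hu', u * h' + h * u' + y * h * h',
        add_mem (add_mem (mul_mem (hle hu) hh') (mul_mem hh (hle hu')))
          (mul_mem (mul_mem (Algebra.subset_adjoin hyW) hh) hh'), by ring⟩
  obtain ⟨u, hu, h, hh, rfl⟩ := hrem
  obtain ⟨N, hN⟩ := exists_iterate_eq_zero hW hh
  -- `0 = δ (u + y h) = h + y δ h`
  have hh0 : h = 0 := by
    refine eq_zero_of_smul_eq_neg_mul (k := k) hy 0 h hN ?_
    rw [map_add, apply_eq_zero_of_mem_adjoin hW₀ hu, leibniz, hy, smul_eq_mul, smul_eq_mul,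
      mul_one, zero_add] at hδf
    rw [zero_add, Nat.cast_one, one_smul]
    linear_combination hδf
  rw [hh0, mul_zero, add_zero]
  exact hu

end Derivation

/-! ### The presentation of the algebra of linear forms -/

namespace RowAlgebra

variable {k : Type*} [Field k] {d m : ℕ}

/-- The linear form `∑ᵢ vᵢ yᵢ` of `k[y₁, …, y_d]` with coefficient vector `v`. -/
noncomputable def lin : (Fin d → k) →ₗ[k] MvPolynomial (Fin d) k :=
  Fintype.linearCombination k MvPolynomial.X

/-- The linear functional on `k ^ d` given by column `e` of `M`. -/
noncomputable def coord (M : Matrix (Fin d) (Fin m) k) (e : Fin m) : (Fin d → k) →ₗ[k] k :=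
  Fintype.linearCombination k fun i => M i e

/-- The derivation of `k[y₁, …, y_d]` that extends `coord M e`. -/
noncomputable def delta (M : Matrix (Fin d) (Fin m) k) (e : Fin m) :
    Derivation k (MvPolynomial (Fin d) k) (MvPolynomial (Fin d) k) :=
  MvPolynomial.mkDerivation k fun i => MvPolynomial.C (M i e)

/-- The algebra map `k[y₁, …, y_d] → B` that sends `yᵢ` to the linear form given by row `i` of
`M`, where the columns outside `E` are replaced by zero. -/
noncomputable def phi (M : Matrix (Fin d) (Fin m) k) (E : Finset (Fin m)) :
    MvPolynomial (Fin d) k →ₐ[k] SquareZeroAlgebra k m :=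
  MvPolynomial.aeval fun i => ∑ j ∈ E, M i j • SquareZeroAlgebra.x k m j

open Classical in
/-- The number of variables `xⱼ`, `j ∈ E`, that occur in the linear form of `B` with coefficient
vector `v`. -/
noncomputable def supportCard (M : Matrix (Fin d) (Fin m) k) (E : Finset (Fin m))
    (v : Fin d → k) : ℕ :=
  (E.filter fun e => coord M e v ≠ 0).card

/-- The polynomials in the linear forms with coefficient vector in `V`. -/
noncomputable def formAlgebra (V : Submodule k (Fin d → k)) :
    Subalgebra k (MvPolynomial (Fin d) k) :=
  Algebra.adjoin k (V.map lin : Set (MvPolynomial (Fin d) k))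

/-- The ideal of `formAlgebra V` generated by the powers `(lin v) ^ (supportCard M E v + 1)`,
`v ∈ V`, as a subspace of the polynomial ring. -/
noncomputable def powerIdeal (M : Matrix (Fin d) (Fin m) k) (E : Finset (Fin m))
    (V : Submodule k (Fin d → k)) : Submodule k (MvPolynomial (Fin d) k) :=
  Submodule.span k {f | ∃ v ∈ V, ∃ a ∈ formAlgebra V, lin v ^ (supportCard M E v + 1) * a = f}

variable {M : Matrix (Fin d) (Fin m) k} {E : Finset (Fin m)} {V : Submodule k (Fin d → k)}
  {e : Fin m}

lemma lin_mem {v : Fin d → k} (hv : v ∈ V) : lin v ∈ V.map lin :=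
  Submodule.mem_map_of_mem hv

lemma lin_mem_formAlgebra {v : Fin d → k} (hv : v ∈ V) : lin v ∈ formAlgebra V :=
  Algebra.subset_adjoin (lin_mem hv)

lemma delta_lin (v : Fin d → k) :
    delta M e (lin v) = algebraMap k (MvPolynomial (Fin d) k) (coord M e v) := by
  simp only [delta, lin, coord, Fintype.linearCombination_apply, map_sum, Derivation.map_smul,
    MvPolynomial.mkDerivation_X, smul_eq_mul, map_mul, MvPolynomial.algebraMap_eq]
  simp only [MvPolynomial.smul_eq_C_mul]

lemma exists_delta_eq (V : Submodule k (Fin d → k)) : ∀ w ∈ V.map lin,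
    ∃ c : k, delta M e w = algebraMap k (MvPolynomial (Fin d) k) c := by
  rintro _ ⟨v, -, rfl⟩
  exact ⟨_, delta_lin v⟩

lemma delta_eq_zero_of_mem_formAlgebra (hV : ∀ v ∈ V, coord M e v = 0)
    {f : MvPolynomial (Fin d) k} (hf : f ∈ formAlgebra V) : delta M e f = 0 := by
  refine Derivation.apply_eq_zero_of_mem_adjoin ?_ hf
  rintro _ ⟨v, hv, rfl⟩
  rw [delta_lin, hV v hv, map_zero]

lemma phi_lin (v : Fin d → k) :
    phi M E (lin v) = ∑ j ∈ E, coord M j v • SquareZeroAlgebra.x k m j := by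
  simp only [phi, lin, coord, Fintype.linearCombination_apply, map_sum, map_smul,
    MvPolynomial.aeval_X, Finset.smul_sum, Finset.sum_smul, smul_eq_mul, mul_smul]
  exact Finset.sum_comm

/-- A sum of `n` elements of square zero has vanishing power `n + 1`. -/
lemma phi_lin_pow (v : Fin d → k) : phi M E (lin v) ^ (supportCard M E v + 1) = 0 := by
  classical
  have : phi M E (lin v) = ∑ j ∈ E.filter fun e => coord M e v ≠ 0,
      coord M j v • SquareZeroAlgebra.x k m j := by
    rw [phi_lin, Finset.sum_filter_of_ne]
    intro j _ hj h
    exact hj (by rw [h, zero_smul])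
  rw [this, supportCard]
  convert SquareZeroAlgebra.sum_smul_x_pow (fun j => coord M j v) _

lemma phi_eq_zero_of_mem_powerIdeal {f : MvPolynomial (Fin d) k} (hf : f ∈ powerIdeal M E V) :
    phi M E f = 0 := by
  have : powerIdeal M E V ≤ LinearMap.ker (phi M E).toLinearMap := by
    rw [powerIdeal, Submodule.span_le]
    rintro _ ⟨v, -, a, -, rfl⟩
    rw [SetLike.mem_coe, LinearMap.mem_ker, AlgHom.toLinearMap_apply, map_mul, map_pow,
      phi_lin_pow, zero_mul]
  exact this hf

lemma powerIdeal_le_formAlgebra : powerIdeal M E V ≤ Subalgebra.toSubmodule (formAlgebra V) := by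
  rw [powerIdeal, Submodule.span_le]
  rintro _ ⟨v, hv, a, ha, rfl⟩
  exact (formAlgebra V).mul_mem (pow_mem (lin_mem_formAlgebra hv) _) ha

lemma mul_mem_powerIdeal {f g : MvPolynomial (Fin d) k} (hf : f ∈ powerIdeal M E V)
    (hg : g ∈ formAlgebra V) : f * g ∈ powerIdeal M E V := by
  induction hf using Submodule.span_induction with
  | mem f hf =>
    obtain ⟨v, hv, a, ha, rfl⟩ := hf
    exact Submodule.subset_span ⟨v, hv, a * g, mul_mem ha hg, (mul_assoc _ _ _).symm⟩
  | zero => rw [zero_mul]; exact zero_mem _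
  | add f f' _ _ hf hf' => rw [add_mul]; exact add_mem hf hf'
  | smul c f _ hf => rw [smul_mul_assoc]; exact Submodule.smul_mem _ c hf

lemma formAlgebra_mono {V' : Submodule k (Fin d → k)} (h : V' ≤ V) :
    formAlgebra V' ≤ formAlgebra V :=
  Algebra.adjoin_mono (Submodule.map_mono h)

lemma powerIdeal_mono {V' : Submodule k (Fin d → k)} (h : V' ≤ V) :
    powerIdeal M E V' ≤ powerIdeal M E V :=
  Submodule.span_mono fun _ ⟨v, hv, a, ha, hf⟩ => ⟨v, h hv, a, formAlgebra_mono h ha, hf⟩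

lemma supportCard_insert_of_eq_zero {v : Fin d → k} (hv : coord M e v = 0) :
    supportCard M (insert e E) v = supportCard M E v := by
  classical
  rw [supportCard, supportCard, Finset.filter_insert, if_neg (not_not.mpr hv)]

lemma supportCard_insert_of_ne_zero (he : e ∉ E) {v : Fin d → k} (hv : coord M e v ≠ 0) :
    supportCard M (insert e E) v = supportCard M E v + 1 := by
  classical
  rw [supportCard, supportCard, Finset.filter_insert, if_pos hv,
    Finset.card_insert_of_notMem fun h => he (Finset.mem_of_mem_filter _ h)]

lemma powerIdeal_insert_of_eq_zero (hV : ∀ v ∈ V, coord M e v = 0) :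
    powerIdeal M (insert e E) V = powerIdeal M E V := by
  rw [powerIdeal, powerIdeal]
  congr 1
  ext f
  exact exists_congr fun v => and_congr_right fun hv => by
    rw [supportCard_insert_of_eq_zero (hV v hv)]

lemma phi_insert_of_eq_zero (he : e ∉ E) (hV : ∀ v ∈ V, coord M e v = 0)
    {f : MvPolynomial (Fin d) k} (hf : f ∈ formAlgebra V) :
    phi M (insert e E) f = phi M E f := by
  have : formAlgebra V ≤ AlgHom.equalizer (phi M (insert e E)) (phi M E) := by
    refine Algebra.adjoin_le ?_
    rintro _ ⟨v, hv, rfl⟩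
    rw [SetLike.mem_coe, AlgHom.mem_equalizer, phi_lin, phi_lin, Finset.sum_insert he, hV v hv,
      zero_smul, zero_add]
  exact this hf

lemma toDual_phi_insert (he : e ∉ E) (f : MvPolynomial (Fin d) k) :
    SquareZeroAlgebra.toDual e (phi M (insert e E) f) =
      TrivSqZeroExt.inl (phi M E f) + TrivSqZeroExt.inr (phi M E (delta M e f)) := by
  induction f using MvPolynomial.induction_on with
  | C r =>
    rw [← MvPolynomial.algebraMap_eq, AlgHom.commutes, AlgHom.commutes, AlgHom.commutes,
      Derivation.map_algebraMap, map_zero, TrivSqZeroExt.inr_zero, add_zero]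
    rfl
  | add f g hf hg =>
    simp only [map_add, hf, hg, TrivSqZeroExt.inl_add, TrivSqZeroExt.inr_add]
    abel
  | mul_X f i hf =>
    have hX : SquareZeroAlgebra.toDual e (phi M (insert e E) (MvPolynomial.X i)) =
        TrivSqZeroExt.inl (phi M E (MvPolynomial.X i)) +
          TrivSqZeroExt.inr (phi M E (delta M e (MvPolynomial.X i))) := by
      have hE : ∑ j ∈ E, M i j • SquareZeroAlgebra.toDual e (SquareZeroAlgebra.x k m j) =
          TrivSqZeroExt.inl (∑ j ∈ E, M i j • SquareZeroAlgebra.x k m j) := by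
        rw [TrivSqZeroExt.inl_sum]
        refine Finset.sum_congr rfl fun j hj => ?_
        rw [SquareZeroAlgebra.toDual, SquareZeroAlgebra.lift_x,
          if_neg (ne_of_mem_of_not_mem hj he), TrivSqZeroExt.inl_smul]
      rw [phi, MvPolynomial.aeval_X, phi, MvPolynomial.aeval_X, Finset.sum_insert he, map_add,
        map_smul, map_sum]
      simp only [map_smul]
      rw [hE, delta, MvPolynomial.mkDerivation_X, MvPolynomial.aeval_C, add_comm]
      congr 1
      rw [SquareZeroAlgebra.toDual, SquareZeroAlgebra.lift_x, if_pos rfl, DualNumber.eps,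
        ← TrivSqZeroExt.inr_smul, Algebra.algebraMap_eq_smul_one]
    rw [map_mul, map_mul, hf, hX, Derivation.leibniz]
    ext
    · simp
    · simp only [TrivSqZeroExt.snd_mul, TrivSqZeroExt.snd_add, TrivSqZeroExt.fst_add,
        TrivSqZeroExt.snd_inl, TrivSqZeroExt.snd_inr, TrivSqZeroExt.fst_inl, TrivSqZeroExt.fst_inr,
        map_add, smul_eq_mul, map_mul, zero_add, add_zero, MulOpposite.smul_eq_mul_unop,
        MulOpposite.unop_op]
      ring

/-- The derivative with respect to `xₑ` of a polynomial in the row forms is a polynomial in the row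
forms with `xₑ` deleted. -/
lemma deriv_phi_insert (he : e ∉ E) (f : MvPolynomial (Fin d) k) :
    SquareZeroAlgebra.deriv e (phi M (insert e E) f) = phi M E (delta M e f) := by
  rw [SquareZeroAlgebra.deriv_apply, toDual_phi_insert he, TrivSqZeroExt.snd_add,
    TrivSqZeroExt.snd_inl, TrivSqZeroExt.snd_inr, zero_add]

lemma exists_coord_eq_one (hV : ¬ ∀ v ∈ V, coord M e v = 0) : ∃ v ∈ V, coord M e v = 1 := by
  push Not at hV
  obtain ⟨v, hv, hne⟩ := hV
  exact ⟨(coord M e v)⁻¹ • v, Submodule.smul_mem _ _ hv, by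
    rw [map_smul, smul_eq_mul, inv_mul_cancel₀ hne]⟩

variable [CharZero k]

/-- Every relation of the deletion is the `delta M e`-derivative of a relation of `V`. If
`coord M e v ≠ 0`, then `v` has one more variable in its support before the deletion than after,
so the exponent of `lin v` in the relations drops by one, as it does under differentiation. -/
lemma exists_mem_powerIdeal_delta_eq (he : e ∉ E) (hV : ¬ ∀ v ∈ V, coord M e v = 0)
    {f : MvPolynomial (Fin d) k} (hf : f ∈ powerIdeal M E V) :
    ∃ g ∈ powerIdeal M (insert e E) V, delta M e g = f := by
  have hle : powerIdeal M E V ≤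
      (powerIdeal M (insert e E) V).map (delta M e : MvPolynomial (Fin d) k →ₗ[k] _) := by
    refine Submodule.span_le.mpr ?_
    rintro _ ⟨v, hv, a, ha, rfl⟩
    by_cases h0 : coord M e v = 0
    · -- `lin v` is a constant for `delta M e`: it suffices to integrate `a`.
      obtain ⟨y, hy, hy1⟩ := exists_coord_eq_one hV
      obtain ⟨b, hb, hδ⟩ := Derivation.exists_apply_pow_succ_mul (exists_delta_eq V) (lin_mem hy)
        (by rw [hy1]; exact one_ne_zero) (delta_lin (M := M) (e := e) y) ha 0
      refine ⟨lin v ^ (supportCard M E v + 1) * (lin y ^ (0 + 1) * b), Submodule.subset_span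
        ⟨v, hv, _, mul_mem (pow_mem (lin_mem_formAlgebra hy) _) hb, by
          rw [supportCard_insert_of_eq_zero h0]⟩, ?_⟩
      rw [Derivation.coeFn_coe, Derivation.leibniz, hδ, Derivation.leibniz_pow, delta_lin, h0,
        map_zero, smul_zero, smul_zero, smul_zero, add_zero, smul_eq_mul, pow_zero, one_mul]
    · obtain ⟨b, hb, hδ⟩ := Derivation.exists_apply_pow_succ_mul (exists_delta_eq V) (lin_mem hv)
        h0 (delta_lin (M := M) (e := e) v) ha (supportCard M E v + 1)
      exact ⟨_, Submodule.subset_span ⟨v, hv, b, hb, by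
        rw [supportCard_insert_of_ne_zero he h0]⟩, hδ⟩
  obtain ⟨g, hg, hgf⟩ := hle hf
  exact ⟨g, hg, hgf⟩

/-- On `formAlgebra V`, the kernel of `delta M e` consists of the polynomials in the linear forms
that `delta M e` kills. -/
lemma mem_formAlgebra_of_delta_eq_zero (hV : ¬ ∀ v ∈ V, coord M e v = 0)
    {f : MvPolynomial (Fin d) k} (hf : f ∈ formAlgebra V) (hδ : delta M e f = 0) :
    f ∈ formAlgebra (V ⊓ LinearMap.ker (coord M e)) := by
  obtain ⟨y, hy, hy1⟩ := exists_coord_eq_one hV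
  refine Derivation.mem_adjoin_of_apply_eq_zero (δ := delta M e) (exists_delta_eq V) (lin_mem hy)
    (by rw [delta_lin, hy1, map_one]) (Submodule.map_mono inf_le_left) ?_ ?_ hf hδ
  · rintro _ ⟨v, hv, rfl⟩
    rw [delta_lin, show coord M e v = 0 from hv.2, map_zero]
  · rintro _ ⟨v, hv, rfl⟩
    refine ⟨lin (v - coord M e v • y), lin_mem ⟨sub_mem hv (Submodule.smul_mem _ _ hy), ?_⟩,
      coord M e v, ?_⟩
    · rw [SetLike.mem_coe, LinearMap.mem_ker, map_sub, map_smul, hy1, smul_eq_mul, mul_one,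
        sub_self]
    · rw [map_sub, map_smul, sub_add_cancel]

/-- A polynomial in the forms of `V` whose derivative is a relation of the deletion is, modulo
relations of `V`, a polynomial in the forms of the contraction. -/
lemma exists_eq_add_of_delta_mem (he : e ∉ E) (hV : ¬ ∀ v ∈ V, coord M e v = 0)
    {f : MvPolynomial (Fin d) k} (hf : f ∈ formAlgebra V) (hδ : delta M e f ∈ powerIdeal M E V) :
    ∃ g ∈ powerIdeal M (insert e E) V, ∃ u ∈ formAlgebra (V ⊓ LinearMap.ker (coord M e)),
      f = g + u := by
  obtain ⟨g, hg, hgf⟩ := exists_mem_powerIdeal_delta_eq he hV hδ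
  refine ⟨g, hg, f - g, mem_formAlgebra_of_delta_eq_zero hV
    (sub_mem hf (powerIdeal_le_formAlgebra hg)) ?_, by ring⟩
  rw [map_sub, hgf, sub_self]

/-- All relations between the linear forms follow from `(lin v) ^ (supportCard M E v + 1) = 0`. -/
theorem mem_powerIdeal_of_phi_eq_zero (E : Finset (Fin m)) : ∀ (V : Submodule k (Fin d → k)),
    ∀ f ∈ formAlgebra V, phi M E f = 0 → f ∈ powerIdeal M E V := by
  induction E using Finset.induction_on with
  | empty =>
    intro V f hf h0
    -- With no variables left every `lin v` is a relation, so `f` is constant modulo relations.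
    have hc : ∃ c : k, f - algebraMap k _ c ∈ powerIdeal M ∅ V := by
      clear h0
      induction hf using Algebra.adjoin_induction with
      | mem w hw =>
        obtain ⟨v, hv, rfl⟩ := hw
        exact ⟨0, Submodule.subset_span ⟨v, hv, 1, one_mem _, by simp [supportCard]⟩⟩
      | algebraMap r => exact ⟨r, by rw [sub_self]; exact zero_mem _⟩
      | add f g _ _ hf hg =>
        obtain ⟨a, ha⟩ := hf
        obtain ⟨b, hb⟩ := hg
        refine ⟨a + b, ?_⟩
        rw [map_add, add_sub_add_comm]
        exact add_mem ha hb
      | mul f g hf' hg' hf hg =>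
        obtain ⟨a, ha⟩ := hf
        obtain ⟨b, hb⟩ := hg
        refine ⟨a * b, ?_⟩
        have : f * g - algebraMap k _ (a * b) =
            (f - algebraMap k _ a) * g + a • (g - algebraMap k _ b) := by
          rw [Algebra.smul_def, map_mul]; ring
        rw [this]
        exact add_mem (mul_mem_powerIdeal ha hg') (Submodule.smul_mem _ _ hb)
    obtain ⟨c, hc⟩ := hc
    have h := phi_eq_zero_of_mem_powerIdeal hc
    rw [map_sub, h0, AlgHom.commutes, zero_sub, neg_eq_zero,
      FaithfulSMul.algebraMap_eq_zero_iff] at h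
    rwa [h, map_zero, sub_zero] at hc
  | insert e E he ih =>
    have hloop : ∀ (V : Submodule k (Fin d → k)), (∀ v ∈ V, coord M e v = 0) →
        ∀ f ∈ formAlgebra V, phi M (insert e E) f = 0 → f ∈ powerIdeal M (insert e E) V := by
      intro V hV f hf h0
      rw [powerIdeal_insert_of_eq_zero hV]
      exact ih V f hf (by rw [← phi_insert_of_eq_zero he hV hf, h0])
    intro V f hf h0
    by_cases hV : ∀ v ∈ V, coord M e v = 0
    · exact hloop V hV f hf h0
    -- The derivative of `f` is a relation of the deletion, to which the induction applies; what
    -- is left of `f` is a relation of the contraction, on which `e` is a loop.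
    have hδ : phi M E (delta M e f) = 0 := by rw [← deriv_phi_insert he, h0, map_zero]
    obtain ⟨g, hg, u, hu, rfl⟩ := exists_eq_add_of_delta_mem he hV hf
      (ih V _ (Derivation.apply_mem_adjoin (exists_delta_eq V) hf) hδ)
    rw [map_add, phi_eq_zero_of_mem_powerIdeal hg, zero_add] at h0
    exact add_mem hg (powerIdeal_mono inf_le_left
      (hloop _ (fun _ hv => (Submodule.mem_inf.mp hv).2) u hu h0))

end RowAlgebra

/-! ### Deletion and contraction for the Hilbert function -/

namespace RowAlgebra

variable {k : Type*} [Field k] {d m : ℕ}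

/-- The space of linear forms of `B` spanned by the images of the vectors of `V`, where the
variables outside `E` are deleted. -/
noncomputable def forms (M : Matrix (Fin d) (Fin m) k) (E : Finset (Fin m))
    (V : Submodule k (Fin d → k)) : Submodule k (SquareZeroAlgebra k m) :=
  (V.map lin).map (phi M E).toLinearMap

variable {M : Matrix (Fin d) (Fin m) k} {E : Finset (Fin m)} {V : Submodule k (Fin d → k)}
  {e : Fin m}

lemma forms_le_component : forms M E V ≤ squareZeroComponent k m 1 := by
  rintro _ ⟨_, ⟨v, -, rfl⟩, rfl⟩
  rw [AlgHom.toLinearMap_apply, phi_lin]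
  exact sum_mem fun j _ => Submodule.smul_mem _ _ (SquareZeroAlgebra.x_mem_component j)

lemma forms_pow (j : ℕ) : forms M E V ^ j = (V.map lin ^ j).map (phi M E).toLinearMap :=
  (Submodule.map_pow _ _ j).symm

lemma phi_mem_adjoin_forms {f : MvPolynomial (Fin d) k} (hf : f ∈ formAlgebra V) :
    phi M E f ∈ Algebra.adjoin k (forms M E V : Set (SquareZeroAlgebra k m)) := by
  have : (Algebra.adjoin k (forms M E V : Set (SquareZeroAlgebra k m))) =
      (formAlgebra V).map (phi M E) := by
    rw [formAlgebra, AlgHom.map_adjoin]; rfl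
  rw [this]
  exact ⟨f, hf, rfl⟩

lemma forms_insert_of_eq_zero (he : e ∉ E) (hV : ∀ v ∈ V, coord M e v = 0) :
    forms M (insert e E) V = forms M E V := by
  ext b
  refine exists_congr fun f => and_congr_right fun hf => ?_
  rw [AlgHom.toLinearMap_apply, AlgHom.toLinearMap_apply,
    phi_insert_of_eq_zero he hV (Algebra.subset_adjoin hf)]

lemma coord_eq_zero_of_mem_inf_ker : ∀ v ∈ V ⊓ LinearMap.ker (coord M e), coord M e v = 0 :=
  fun _ hv => (Submodule.mem_inf.mp hv).2

lemma forms_insert_inf_ker_le (he : e ∉ E) :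
    forms M E (V ⊓ LinearMap.ker (coord M e)) ≤ forms M (insert e E) V := by
  rw [← forms_insert_of_eq_zero he coord_eq_zero_of_mem_inf_ker]
  exact Submodule.map_mono (Submodule.map_mono inf_le_left)

lemma pow_mono_left {L L' : Submodule k (SquareZeroAlgebra k m)} (h : L ≤ L') (j : ℕ) :
    L ^ j ≤ L' ^ j := by
  induction j with
  | zero => rw [Submodule.pow_zero, Submodule.pow_zero]
  | succ j ih =>
    rw [Submodule.pow_succ, Submodule.pow_succ]
    exact Submodule.mul_le.mpr fun a ha b hb => Submodule.mul_mem_mul (ih ha) (h hb)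

instance finiteDimensional_pow (W : Submodule k (MvPolynomial (Fin d) k))
    [FiniteDimensional k W] (j : ℕ) : FiniteDimensional k ↥(W ^ j) := by
  have hW : W.FG := Module.Finite.iff_fg.mp inferInstance
  exact Module.Finite.iff_fg.mpr (hW.pow j)

instance finiteDimensional_forms_pow (j : ℕ) : FiniteDimensional k ↥(forms M E V ^ j) := by
  rw [forms_pow]
  infer_instance

lemma finrank_forms_pow_zero : Module.finrank k ↥(forms M E V ^ 0) = 1 := by
  rw [Submodule.pow_zero, Submodule.one_eq_range, LinearMap.finrank_range_of_inj,
    Module.finrank_self]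
  exact FaithfulSMul.algebraMap_injective k (SquareZeroAlgebra k m)

lemma finrank_forms_empty_pow_succ (j : ℕ) :
    Module.finrank k ↥(forms M ∅ V ^ (j + 1)) = 0 := by
  have : forms M ∅ V = ⊥ := by
    rw [eq_bot_iff]
    rintro _ ⟨_, ⟨v, -, rfl⟩, rfl⟩
    rw [AlgHom.toLinearMap_apply, phi_lin, Finset.sum_empty]
    exact zero_mem _
  rw [this, Submodule.pow_succ, Submodule.mul_bot, finrank_bot]

variable [CharZero k]

/-- Differentiation with respect to `xₑ` maps the degree `j + 1` part of the algebra of `V` onto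
the degree `j` part of the deletion. -/
lemma map_deriv_forms_pow (he : e ∉ E) (hV : ¬ ∀ v ∈ V, coord M e v = 0) (j : ℕ) :
    (forms M (insert e E) V ^ (j + 1)).map (SquareZeroAlgebra.deriv e) = forms M E V ^ j := by
  rw [forms_pow, forms_pow]
  refine le_antisymm ?_ ?_
  · rintro _ ⟨_, ⟨f, hf, rfl⟩, rfl⟩
    rw [AlgHom.toLinearMap_apply, deriv_phi_insert he]
    exact ⟨_, Derivation.apply_mem_pow (exists_delta_eq V) j f hf, rfl⟩
  · rintro _ ⟨f, hf, rfl⟩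
    obtain ⟨y, hy, hy1⟩ := exists_coord_eq_one hV
    obtain ⟨b, hb, hδ⟩ := Derivation.exists_mem_pow_apply_eq (exists_delta_eq V) (lin_mem hy)
      (by rw [hy1]; exact one_ne_zero) (delta_lin (M := M) (e := e) y) j 0 f hf
    rw [pow_zero, one_mul] at hδ
    rw [show 0 + 1 + j = j + 1 by omega] at hb
    refine ⟨_, ⟨b, hb, rfl⟩, ?_⟩
    rw [AlgHom.toLinearMap_apply, AlgHom.toLinearMap_apply, deriv_phi_insert he, hδ]

/-- The elements killed by differentiation with respect to `xₑ` form the contraction. This is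
where the presentation by powers of linear forms is needed. -/
lemma forms_pow_inf_ker_deriv (he : e ∉ E) (hV : ¬ ∀ v ∈ V, coord M e v = 0) (j : ℕ) :
    forms M (insert e E) V ^ j ⊓ LinearMap.ker (SquareZeroAlgebra.deriv e) =
      forms M E (V ⊓ LinearMap.ker (coord M e)) ^ j := by
  refine le_antisymm ?_ (le_inf (pow_mono_left (forms_insert_inf_ker_le he) j) ?_)
  · rintro b ⟨hb, hker⟩
    have hdeg := SquareZeroAlgebra.pow_le_component forms_le_component j hb
    rw [SetLike.mem_coe, forms_pow] at hb
    obtain ⟨f, hf, rfl⟩ := hb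
    rw [SetLike.mem_coe, LinearMap.mem_ker, AlgHom.toLinearMap_apply, deriv_phi_insert he] at hker
    have hfV : f ∈ formAlgebra V := Submodule.pow_le_adjoin _ j hf
    obtain ⟨g, hg, u, hu, rfl⟩ := exists_eq_add_of_delta_mem he hV hfV
      (mem_powerIdeal_of_phi_eq_zero E V _
        (Derivation.apply_mem_adjoin (exists_delta_eq V) hfV) hker)
    rw [← SquareZeroAlgebra.adjoin_inf_component forms_le_component]
    refine ⟨?_, hdeg⟩
    rw [AlgHom.toLinearMap_apply, map_add, phi_eq_zero_of_mem_powerIdeal hg, zero_add,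
      phi_insert_of_eq_zero he coord_eq_zero_of_mem_inf_ker hu]
    exact phi_mem_adjoin_forms hu
  · rw [forms_pow]
    rintro _ ⟨f, hf, rfl⟩
    have hf' : f ∈ formAlgebra (V ⊓ LinearMap.ker (coord M e)) :=
      Submodule.pow_le_adjoin _ j hf
    rw [LinearMap.mem_ker, AlgHom.toLinearMap_apply,
      ← phi_insert_of_eq_zero he coord_eq_zero_of_mem_inf_ker hf', deriv_phi_insert he,
      delta_eq_zero_of_mem_formAlgebra coord_eq_zero_of_mem_inf_ker hf', map_zero]

lemma finrank_forms_pow_succ (he : e ∉ E) (hV : ¬ ∀ v ∈ V, coord M e v = 0) (j : ℕ) :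
    Module.finrank k ↥(forms M (insert e E) V ^ (j + 1)) =
      Module.finrank k ↥(forms M E V ^ j) +
        Module.finrank k ↥(forms M E (V ⊓ LinearMap.ker (coord M e)) ^ (j + 1)) := by
  rw [← map_deriv_forms_pow he hV, ← forms_pow_inf_ker_deriv he hV]
  have := ((SquareZeroAlgebra.deriv e).domRestrict
    (forms M (insert e E) V ^ (j + 1))).finrank_range_add_finrank_ker
  rw [LinearMap.range_domRestrict, LinearMap.ker_domRestrict] at this
  rw [← this, ← Submodule.finrank_map_subtype_eq, Submodule.map_comap_subtype]

end RowAlgebra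

/-! ### Deletion and contraction for the Tutte polynomial -/

namespace RowAlgebra

variable {k : Type*} [Field k] {d m : ℕ}

/-- The vectors of `V` on which all functionals `coord M e`, `e ∈ S`, vanish. -/
noncomputable def vanishing (M : Matrix (Fin d) (Fin m) k) (V : Submodule k (Fin d → k))
    (S : Finset (Fin m)) : Submodule k (Fin d → k) :=
  V ⊓ ⨅ e ∈ S, LinearMap.ker (coord M e)

/-- The rank of the functionals `coord M e`, `e ∈ S`, restricted to `V`. -/
noncomputable def rankOn (M : Matrix (Fin d) (Fin m) k) (V : Submodule k (Fin d → k))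
    (S : Finset (Fin m)) : ℕ :=
  Module.finrank k V - Module.finrank k (vanishing M V S)

/-- The specialisation `t ^ (|E| - r(E)) T(1 + t, t⁻¹)` of the Tutte polynomial of the functionals
`coord M e`, `e ∈ E`, on `V`, written as a sum of polynomials. -/
noncomputable def tutteSum (M : Matrix (Fin d) (Fin m) k) (E : Finset (Fin m))
    (V : Submodule k (Fin d → k)) : Polynomial ℤ :=
  ∑ S ∈ E.powerset, Polynomial.X ^ (E.card - S.card) *
    (1 - Polynomial.X) ^ (S.card - rankOn M V S)

variable {M : Matrix (Fin d) (Fin m) k} {E S : Finset (Fin m)} {V : Submodule k (Fin d → k)}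
  {e : Fin m}

lemma vanishing_insert : vanishing M V (insert e S) =
    vanishing M (V ⊓ LinearMap.ker (coord M e)) S := by
  rw [vanishing, vanishing, Finset.iInf_insert, inf_assoc]

lemma finrank_inf_ker (hV : ¬ ∀ v ∈ V, coord M e v = 0) :
    Module.finrank k ↥(V ⊓ LinearMap.ker (coord M e)) + 1 = Module.finrank k V := by
  have h : (coord M e).domRestrict V ≠ 0 := by
    intro h
    exact hV fun v hv => LinearMap.congr_fun h ⟨v, hv⟩
  rw [← Module.Dual.finrank_ker_add_one_of_ne_zero h, LinearMap.ker_domRestrict,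
    ← Submodule.finrank_map_subtype_eq, Submodule.map_comap_subtype]

lemma finrank_vanishing_le : Module.finrank k (vanishing M V S) ≤ Module.finrank k V :=
  Submodule.finrank_mono inf_le_left

lemma inf_ker_eq_self (hV : ∀ v ∈ V, coord M e v = 0) : V ⊓ LinearMap.ker (coord M e) = V :=
  inf_eq_left.mpr hV

lemma rankOn_insert_of_eq_zero (hV : ∀ v ∈ V, coord M e v = 0) :
    rankOn M V (insert e S) = rankOn M V S := by
  rw [rankOn, rankOn, vanishing_insert, inf_ker_eq_self hV]

lemma rankOn_insert_of_ne_zero (hV : ¬ ∀ v ∈ V, coord M e v = 0) :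
    rankOn M V (insert e S) = rankOn M (V ⊓ LinearMap.ker (coord M e)) S + 1 := by
  have := finrank_inf_ker hV
  have h := finrank_vanishing_le (M := M) (V := V ⊓ LinearMap.ker (coord M e)) (S := S)
  rw [rankOn, rankOn, vanishing_insert]
  omega

lemma rankOn_le_card (M : Matrix (Fin d) (Fin m) k) (S : Finset (Fin m)) :
    ∀ V : Submodule k (Fin d → k), rankOn M V S ≤ S.card := by
  induction S using Finset.induction_on with
  | empty =>
    intro V
    have : vanishing M V ∅ = V :=
      inf_eq_left.mpr (le_iInf₂ fun e he => absurd he (Finset.notMem_empty e))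
    rw [rankOn, this, Nat.sub_self]
    exact Nat.zero_le _
  | insert e S he ih =>
    intro V
    rw [Finset.card_insert_of_notMem he]
    by_cases hV : ∀ v ∈ V, coord M e v = 0
    · rw [rankOn_insert_of_eq_zero hV]; exact (ih V).trans (Nat.le_succ _)
    · rw [rankOn_insert_of_ne_zero hV]; exact Nat.succ_le_succ (ih _)

lemma tutteSum_insert (he : e ∉ E) (V : Submodule k (Fin d → k)) :
    tutteSum M (insert e E) V = Polynomial.X * tutteSum M E V +
      ∑ S ∈ E.powerset, Polynomial.X ^ (E.card - S.card) *
        (1 - Polynomial.X) ^ (S.card + 1 - rankOn M V (insert e S)) := by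
  rw [tutteSum, Finset.sum_powerset_insert he, tutteSum, Finset.mul_sum]
  congr 1
  · refine Finset.sum_congr rfl fun S hS => ?_
    have := Finset.card_le_card (Finset.mem_powerset.mp hS)
    rw [Finset.card_insert_of_notMem he, Nat.succ_sub this, pow_succ]
    ring
  · refine Finset.sum_congr rfl fun S hS => ?_
    rw [Finset.card_insert_of_notMem he,
      Finset.card_insert_of_notMem fun h => he (Finset.mem_powerset.mp hS h),
      Nat.add_sub_add_right]

lemma tutteSum_insert_of_eq_zero (he : e ∉ E) (hV : ∀ v ∈ V, coord M e v = 0) :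
    tutteSum M (insert e E) V = tutteSum M E V := by
  have : ∑ S ∈ E.powerset, Polynomial.X ^ (E.card - S.card) *
        (1 - Polynomial.X) ^ (S.card + 1 - rankOn M V (insert e S)) =
      (1 - Polynomial.X) * tutteSum M E V := by
    rw [tutteSum, Finset.mul_sum]
    refine Finset.sum_congr rfl fun S _ => ?_
    rw [rankOn_insert_of_eq_zero hV, Nat.succ_sub (rankOn_le_card M S V), pow_succ]
    ring
  rw [tutteSum_insert he, this]
  ring

lemma tutteSum_insert_of_ne_zero (he : e ∉ E) (hV : ¬ ∀ v ∈ V, coord M e v = 0) :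
    tutteSum M (insert e E) V = Polynomial.X * tutteSum M E V +
      tutteSum M E (V ⊓ LinearMap.ker (coord M e)) := by
  rw [tutteSum_insert he]
  congr 1
  rw [tutteSum]
  refine Finset.sum_congr rfl fun S _ => ?_
  rw [rankOn_insert_of_ne_zero hV, Nat.add_sub_add_right]

lemma natDegree_tutteSum_le : (tutteSum M E V).natDegree ≤ E.card := by
  refine Polynomial.natDegree_sum_le_of_forall_le _ _ fun S hS => ?_
  have hS := Finset.card_le_card (Finset.mem_powerset.mp hS)
  have h1 : (1 - Polynomial.X : Polynomial ℤ).natDegree ≤ 1 := by compute_degree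
  have h2 := Polynomial.natDegree_pow_le_of_le (S.card - rankOn M V S) h1
  refine (Polynomial.natDegree_mul_le_of_le (Polynomial.natDegree_X_pow_le _) h2).trans ?_
  omega

/-- The Hilbert function of the algebra generated by `forms M E V` and the coefficients of
`tutteSum M E V` satisfy the same deletion-contraction recursion. -/
theorem finrank_forms_pow [CharZero k] (E : Finset (Fin m)) :
    ∀ (V : Submodule k (Fin d → k)) (j : ℕ),
      (Module.finrank k ↥(forms M E V ^ j) : ℤ) = (tutteSum M E V).coeff j := by
  induction E using Finset.induction_on with
  | empty =>
    intro V j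
    have : tutteSum M ∅ V = 1 := by simp [tutteSum]
    rw [this, Polynomial.coeff_one]
    rcases j with _ | j
    · rw [finrank_forms_pow_zero, if_pos rfl, Nat.cast_one]
    · rw [finrank_forms_empty_pow_succ, if_neg (Nat.succ_ne_zero j), Nat.cast_zero]
  | insert e E he ih =>
    intro V j
    by_cases hV : ∀ v ∈ V, coord M e v = 0
    · rw [forms_insert_of_eq_zero he hV, tutteSum_insert_of_eq_zero he hV, ih]
    rw [tutteSum_insert_of_ne_zero he hV, Polynomial.coeff_add, ← ih]
    rcases j with _ | j
    · rw [Polynomial.coeff_X_mul_zero, finrank_forms_pow_zero, finrank_forms_pow_zero, zero_add]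
    · rw [Polynomial.coeff_X_mul, finrank_forms_pow_succ he hV, ← ih, Nat.cast_add]

end RowAlgebra

/-! ### The Poincaré polynomial -/

namespace RowAlgebra

variable {k : Type*} [Field k] {d m : ℕ}

lemma forms_univ_top (M : Matrix (Fin d) (Fin m) k) :
    forms M Finset.univ ⊤ = Submodule.span k (Set.range (rowForm M)) := by
  have hX : (fun i => (phi M Finset.univ).toLinearMap (MvPolynomial.X i)) = rowForm M := by
    funext i
    rw [AlgHom.toLinearMap_apply, phi, MvPolynomial.aeval_X]
    rfl
  rw [forms, Submodule.map_top, lin, Fintype.range_linearCombination, Submodule.map_span,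
    ← Set.range_comp, ← hX]
  rfl

lemma rowAlgebraComponent_eq (M : Matrix (Fin d) (Fin m) k) (j : ℕ) :
    rowAlgebraComponent M j = forms M Finset.univ ⊤ ^ j := by
  rw [rowAlgebraComponent, rowAlgebra, ← Algebra.adjoin_span, ← forms_univ_top,
    SquareZeroAlgebra.adjoin_inf_component forms_le_component]

lemma poincarePolynomial_eq_tutteSum [CharZero k] (M : Matrix (Fin d) (Fin m) k) :
    poincarePolynomial M = tutteSum M Finset.univ ⊤ := by
  rw [Polynomial.as_sum_range' (tutteSum M Finset.univ ⊤) (m + 1)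
    (Nat.lt_succ_of_le (natDegree_tutteSum_le.trans_eq (Finset.card_fin m))), poincarePolynomial]
  refine Finset.sum_congr rfl fun j _ => ?_
  rw [rowAlgebraComponent_eq, finrank_forms_pow]

/-! ### Rank functions -/

/-- On the whole space, `rankOn` is the rank of a set of columns, by rank-nullity and the equality
of row and column rank. -/
lemma rankOn_top (M : Matrix (Fin d) (Fin m) k) (S : Finset (Fin m)) :
    rankOn M ⊤ S = Module.finrank k (Submodule.span k (M.col '' S)) := by
  set A : Matrix (Fin d) S k := M.submatrix id Subtype.val with hA
  have hker : LinearMap.ker A.vecMulLinear = vanishing M ⊤ S := by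
    ext v
    simp only [vanishing, top_inf_eq, Submodule.mem_iInf, LinearMap.mem_ker, funext_iff,
      Matrix.vecMulLinear_apply, Subtype.forall]
    exact forall₂_congr fun e he => Iff.rfl
  have hrange : Module.finrank k (LinearMap.range A.vecMulLinear) =
      Module.finrank k (Submodule.span k (M.col '' S)) := by
    rw [range_vecMulLinear, ← Matrix.rank_eq_finrank_span_row, Matrix.rank_eq_finrank_span_cols,
      Set.image_eq_range]
    rfl
  have := A.vecMulLinear.finrank_range_add_finrank_ker
  rw [hrange, hker] at this
  rw [rankOn, finrank_top, ← this, Nat.add_sub_cancel]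

lemma encard_eq_finrank_span {ι W : Type*} [AddCommGroup W] [Module k W] {v : ι → W} {I : Set ι}
    [Finite I] (hI : LinearIndepOn k v I) :
    I.encard = (Module.finrank k (Submodule.span k (v '' I)) : ℕ∞) := by
  have := Fintype.ofFinite I
  rw [Set.image_eq_range, finrank_span_eq_card hI, Set.encard, ENat.card_eq_coe_fintype_card]

lemma matroidRank_image {M : Matrix (Fin d) (Fin m) k} {α : Type*} {𝓜 : Matroid α} {e : Fin m → α}
    (he : Set.BijOn e Set.univ 𝓜.E)
    (hI : ∀ I : Set (Fin m), 𝓜.Indep (e '' I) ↔ LinearIndepOn k M.col I) (S : Set (Fin m)) :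
    matroidRank 𝓜 (e '' S) = Module.finrank k (Submodule.span k (M.col '' S)) := by
  have hinj : Function.Injective e := Set.injOn_univ.mp he.injOn
  have h : 𝓜.eRk (e '' S) = (Module.finrank k (Submodule.span k (M.col '' S)) : ℕ∞) := by
    refine le_antisymm (Matroid.eRk_le_iff.mpr fun J hJ hJi => ?_) ?_
    · obtain ⟨I, hIS, rfl⟩ := Set.subset_image_iff.mp hJ
      rw [hinj.injOn.encard_image, encard_eq_finrank_span ((hI I).mp hJi), Nat.cast_le]
      exact Submodule.finrank_mono (Submodule.span_mono (Set.image_mono hIS))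
    · obtain ⟨I, hIS, -, hspan, hli⟩ :=
        exists_linearIndepOn_extension (linearIndepOn_empty k M.col) (Set.empty_subset S)
      have hle := ((hI I).mpr hli).encard_le_eRk_of_subset (Set.image_mono hIS)
      rw [hinj.injOn.encard_image, encard_eq_finrank_span hli] at hle
      exact le_trans (Nat.cast_le.mpr (Submodule.finrank_mono (Submodule.span_le.mpr hspan))) hle
  rw [matroidRank, h, ENat.toNat_natCast]

lemma matroidRank_ground {M : Matrix (Fin d) (Fin m) k} {α : Type*} {𝓜 : Matroid α}
    (hrep : Represents M 𝓜) : matroidRank 𝓜 𝓜.E = M.rank := by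
  obtain ⟨e, he, hI⟩ := hrep
  rw [← he.image_eq, matroidRank_image he hI, Set.image_univ, Matrix.rank_eq_finrank_span_cols]

lemma ncard_ground {M : Matrix (Fin d) (Fin m) k} {α : Type*} {𝓜 : Matroid α}
    (hrep : Represents M 𝓜) : 𝓜.E.ncard = m := by
  obtain ⟨e, he, -⟩ := hrep
  rw [← he.image_eq, he.injOn.ncard_image, Set.ncard_univ, Nat.card_fin]

/-! ### The Tutte polynomial -/

open LaurentPolynomial in
/-- The monomials of `t ^ (m - d) T(1 + t, t⁻¹)` are polynomials in `t`, because
`t⁻¹ - 1 = t⁻¹ (1 - t)`; the rank `d` cancels. -/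
lemma T_mul_tutte_term {m d s r : ℕ} (hrs : r ≤ s) (hrd : r ≤ d) (hsm : s ≤ m) :
    (T ((m : ℤ) - d) : LaurentPolynomial ℤ) * ((1 + T 1 - 1) ^ (d - r) * (T (-1) - 1) ^ (s - r)) =
      Polynomial.toLaurent
        (Polynomial.X ^ (m - s) * (1 - Polynomial.X) ^ (s - r) : Polynomial ℤ) := by
  have h : (T (-1) - 1 : LaurentPolynomial ℤ) = T (-1) * (1 - T 1) := by
    rw [mul_sub, mul_one, ← T_add, neg_add_cancel, T_zero]
  rw [h, add_sub_cancel_left, mul_pow, T_pow, T_pow, map_mul, map_pow, map_pow, map_sub, map_one,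
    Polynomial.toLaurent_X, T_pow, ← mul_assoc, ← mul_assoc, ← T_add, ← T_add]
  congr 2
  push_cast [Nat.cast_sub hrs, Nat.cast_sub hrd, Nat.cast_sub hsm]
  ring

open LaurentPolynomial in
lemma toLaurent_poincarePolynomial [CharZero k] {M : Matrix (Fin d) (Fin m) k} (hrank : M.rank = d)
    {α : Type*} {𝓜 : Matroid α} [𝓜.Finite] (hrep : Represents M 𝓜) :
    Polynomial.toLaurent (poincarePolynomial M) =
      T ((m : ℤ) - (d : ℤ)) *
        MvPolynomial.aeval ![(1 + T 1 : LaurentPolynomial ℤ), T (-1)] (tuttePolynomial 𝓜) := by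
  classical
  have hd := matroidRank_ground hrep
  rw [hrank] at hd
  obtain ⟨e, he, hI⟩ := hrep
  have hinj : Function.Injective e := Set.injOn_univ.mp he.injOn
  rw [poincarePolynomial_eq_tutteSum, tutteSum, tuttePolynomial, map_sum, map_sum, Finset.mul_sum]
  refine Finset.sum_bij (fun S _ => S.image e) ?_ ?_ ?_ ?_
  · intro S _
    rw [Finset.mem_powerset]
    intro a ha
    obtain ⟨i, -, rfl⟩ := Finset.mem_image.mp ha
    exact 𝓜.ground_finite.mem_toFinset.mpr (he.mapsTo (Set.mem_univ i))
  · exact fun S _ S' _ h => Finset.image_injective hinj h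
  · intro Y hY
    have hY' : (Y : Set α) ⊆ e '' Set.univ := fun a ha => he.image_eq ▸
      𝓜.ground_finite.mem_toFinset.mp (Finset.mem_powerset.mp hY ha)
    obtain ⟨S, -, hS⟩ := Finset.subset_set_image_iff.mp hY'
    exact ⟨S, Finset.mem_powerset.mpr (Finset.subset_univ S), hS⟩
  · intro S _
    have hr : matroidRank 𝓜 (S.image e : Set α) = rankOn M ⊤ S := by
      rw [Finset.coe_image, matroidRank_image he hI, rankOn_top]
    have hrd : rankOn M ⊤ S ≤ d := by
      rw [rankOn, finrank_top, Module.finrank_fin_fun]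
      exact Nat.sub_le _ _
    rw [hd, hr, Finset.card_image_of_injective S hinj, Finset.card_fin,
      ← T_mul_tutte_term (rankOn_le_card M S ⊤) hrd ((Finset.card_le_univ S).trans_eq
        (Fintype.card_fin m))]
    simp

end RowAlgebra

/-- The second conjunct is an identity of Laurent polynomials in `t = LaurentPolynomial.T 1`. -/
theorem corollary1p6 {k : Type*} [Field k] [CharZero k] {d m : ℕ}
    (M : Matrix (Fin d) (Fin m) k) (hrank : M.rank = d) (hcol : ∀ j : Fin m, M.col j ≠ 0)
    {α : Type*} (𝓜 : Matroid α) [𝓜.Finite] (hrep : Represents M 𝓜) :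
    (∀ {k' : Type*} [Field k'] [CharZero k'] {d' m' : ℕ} (N : Matrix (Fin d') (Fin m') k'),
      N.rank = d' → (∀ j : Fin m', N.col j ≠ 0) → Represents N 𝓜 →
        poincarePolynomial N = poincarePolynomial M) ∧
    Polynomial.toLaurent (poincarePolynomial M) =
      LaurentPolynomial.T ((m : ℤ) - (d : ℤ)) *
        MvPolynomial.aeval
          ![(1 + LaurentPolynomial.T 1 : LaurentPolynomial ℤ), LaurentPolynomial.T (-1)]
          (tuttePolynomial 𝓜) := by
  refine ⟨fun N hN _ hrepN => ?_, RowAlgebra.toLaurent_poincarePolynomial hrank hrep⟩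
  apply Polynomial.toLaurent_injective
  rw [RowAlgebra.toLaurent_poincarePolynomial hrank hrep,
    RowAlgebra.toLaurent_poincarePolynomial hN hrepN, ← RowAlgebra.ncard_ground hrep,
    ← RowAlgebra.ncard_ground hrepN, ← hrank, ← hN, ← RowAlgebra.matroidRank_ground hrep,
    ← RowAlgebra.matroidRank_ground hrepN]
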